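/- Formulas are built from a countably infinite set of propositional variables $p,q,r,\dots$ with $\bot$, $\land$, $\lor$, an (intuitionistic) implication $\to$ and a (classical) implication $\supset$. A formula is \emph{disjunction-free} if $\lor$ does not occur in it, \emph{$\bot$-free} if $\bot$ does not occur in it, and \emph{implicational} if $\to$ and $\supset$ are its only connectives. Let $\mathbf{S}^-_\bot\mathbf{2}$ be the Hilbert-style system whose axioms are the single formulas \begin{itemize} \item $\bot\to p$; \item $p\to(q\to p)$, $\;(p\to(q\to r))\to((p\to q)\to(p\to r))$; \item $(p\land q)\to p$, $\;(p\land q)\to q$, $\;(r\to p)\to((r\to q)\to(r\to(p\land q)))$; \item $p\to(p\lor q)$, $\;q\to(p\lor q)$, $\;(p\to r)\to((q\to r)\to((p\lor q)\to r))$; \item $(p\to q)\supset(p\supset q)$, $\;(p\supset(q\supset r))\to((p\supset q)\supset(p\supset r))$; \item $(p\supset(q\to r))\to(q\to(p\supset r))$, $\;(p\to(q\supset r))\to(q\supset(p\to r))$; \item $((p\supset q)\supset r)\to((p\supset r)\to r)$; \end{itemize} and whose rules are modus ponens for $\supset$ (from $A$ and $A\supset B$ infer $B$) and substitution (from $A$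 infer $A[p/B]$, for any variable $p$ and formula $B$). Let $\mathbf{S}_\bot\mathbf{2}$ be $\mathbf{S}^-_\bot\mathbf{2}$ together with the further axiom $$(\mathrm{AxM6}')\qquad (p\supset r)\to((q\supset r)\to((p\lor q)\supset r)).$$ Let $\mathbf{S}^-\mathbf{2}$ and $\mathbf{S2}$ be the systems obtained from these two by dropping the axiom $\bot\to p$ and restricting the language to $\bot$-free formulas. For a system $\mathbf{X}$ and a formula $A$, $\mathbf{X}+A$ is $\mathbf{X}$ with $A$ as an additional axiom. A rule $\mathsf{R}$ is a set of inference figures $A_1,\dots,A_n\,/\,B$ (in particular, it may be a single figure). It is admissible in $\mathbf{X}$ if, for each of its figures, provability of $A_1,\dots,A_n$ in $\mathbf{X}$ implies provability of $B$ in $\mathbf{X}$; and $\mathbf{X}+\mathsf{R}$ is $\mathbf{X}$ with the figures of $\mathsf{R}$ as additional inference steps (the figures are used as they stand; their substitution instances are available only if they also belong to $\mathsf{R}$). Then: \begin{enumerate} \item There is no disjunction-free formula $A$ such that (i) $\mathbf{S}_\bot\mathbf{2}\vdash A$ and (ii) $\mathbf{S}^-_\bot\mathbf{2}+A\vdash(\mathrm{AxM6}')$.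 \item There is no rule $\mathsf{R}$, all of whose figures have a disjunction-free conclusion $B$, such that (i) $\mathsf{R}$ is admissible in $\mathbf{S}_\bot\mathbf{2}$ and (ii) $\mathbf{S}^-_\bot\mathbf{2}+\mathsf{R}\vdash(\mathrm{AxM6}')$. \item Hence $(\mathrm{AxM6}')$ cannot be replaced by an implicational axiom: there is no implicational formula $A$ such that $\mathbf{S}^-_\bot\mathbf{2}+A$ and $\mathbf{S}_\bot\mathbf{2}$ prove the same formulas. \item Likewise without $\bot$: there is no disjunction-free and $\bot$-free formula $A$ such that (i) $\mathbf{S2}\vdash A$ and (ii) $\mathbf{S}^-\mathbf{2}+A\vdash(\mathrm{AxM6}')$. \end{enumerate} -/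

import Mathlib

namespace MixedLogic

/-- Formulas of the full language: propositional variables (indexed by `ℕ`), absurdity,
conjunction, disjunction, intuitionistic implication `imp` (written `→` in the literature)
and classical implication `cimp` (written `⊃` in the literature). -/
inductive Form : Type
  | var : ℕ → Form
  | bot : Form
  | and : Form → Form → Form
  | or : Form → Form → Form
  | imp : Form → Form → Form
  | cimp : Form → Form → Form

namespace Form

/-- `A.subst p B` is `A[p/B]`: every occurrence of the variable `p` in `A` is replaced by `B`. -/
def subst : Form → ℕ → Form → Form
  | var n, p, B => if n = p then B else var n
  | bot, _, _ => bot
  | and A₁ A₂, p, B => and (subst A₁ p B) (subst A₂ p B)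
  | or A₁ A₂, p, B => or (subst A₁ p B) (subst A₂ p B)
  | imp A₁ A₂, p, B => imp (subst A₁ p B) (subst A₂ p B)
  | cimp A₁ A₂, p, B => cimp (subst A₁ p B) (subst A₂ p B)

/-- The formula contains no disjunction. -/
def DisjFree : Form → Prop
  | var _ => True
  | bot => True
  | and A B => DisjFree A ∧ DisjFree B
  | or _ _ => False
  | imp A B => DisjFree A ∧ DisjFree B
  | cimp A B => DisjFree A ∧ DisjFree B

/-- The formula contains no absurdity constant. -/
def BotFree : Form → Prop
  | var _ => True
  | bot => False
  | and A B => BotFree A ∧ BotFree B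
  | or A B => BotFree A ∧ BotFree B
  | imp A B => BotFree A ∧ BotFree B
  | cimp A B => BotFree A ∧ BotFree B

/-- The two implications are the only connectives of the formula. -/
def Implicational : Form → Prop
  | var _ => True
  | bot => False
  | and _ _ => False
  | or _ _ => False
  | imp A B => Implicational A ∧ Implicational B
  | cimp A B => Implicational A ∧ Implicational B

end Form

/-- An inference figure with premises `A₁, …, Aₙ` and conclusion `B`. -/
structure Figure : Type where
  prems : List Form
  concl : Form

/-- A Hilbert-style system with substitution: a language (the set of its formulas), a set of
single formulas taken as axioms, and a set of inference figures, which may be used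
in addition to modus ponens for `⊃` and to substitution. -/
structure HSystem : Type where
  lang : Set Form
  ax : Set Form
  figs : Set Figure

namespace HSystem

/-- Provability (without assumptions) in a system: its theorems are generated from the axioms by
modus ponens for `⊃`, substitution of formulas of the language, and the additional figures. -/
inductive Provable (S : HSystem) : Form → Prop
  | ofAx {A : Form} : A ∈ S.ax → Provable S A
  | mp {A B : Form} : Provable S A → Provable S (Form.cimp A B) → Provable S B
  | sub {A : Form} (p : ℕ) (B : Form) : B ∈ S.lang → Provable S A →
      Provable S (A.subst p B)
  | fig (F : Figure) : F ∈ S.figs → (∀ A ∈ F.prems, Provable S A) → Provable S F.concl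

/-- The system `S + A`: the formula `A` is added as an axiom. -/
def addAx (S : HSystem) (A : Form) : HSystem :=
  { S with ax := insert A S.ax }

/-- The system `S + R`: the rule `R`, a set of inference figures, is added. -/
def addRule (S : HSystem) (R : Set Figure) : HSystem :=
  { S with figs := S.figs ∪ R }

/-- `R` is admissible in `S`: for each figure of `R`, if all its premises are provable in `S`,
then so is its conclusion. -/
def Admissible (S : HSystem) (R : Set Figure) : Prop :=
  ∀ F ∈ R, (∀ A ∈ F.prems, S.Provable A) → S.Provable F.concl

end HSystem

section Systems

open Form

local infixr:60 " ⇒ᵢ " => Form.imp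
local infixr:60 " ⊃ᶜ " => Form.cimp
local infixl:65 " ∨ₗ " => Form.or
local infixl:66 " ∧ₗ " => Form.and

/-- The variable `p`. -/
abbrev vp : Form := var 0

/-- The variable `q`. -/
abbrev vq : Form := var 1

/-- The variable `r`. -/
abbrev vr : Form := var 2

/-- `(p ⊃ r) → ((q ⊃ r) → ((p ∨ q) ⊃ r))` -/
def axM6 : Form := (vp ⊃ᶜ vr) ⇒ᵢ ((vq ⊃ᶜ vr) ⇒ᵢ ((vp ∨ₗ vq) ⊃ᶜ vr))

/-- `⊥ → p` -/
def ax0 : Form := bot ⇒ᵢ vp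

/-- The axioms of positive intuitionistic logic and the axioms for `⊃` other than `axM6`. -/
def baseAx : Set Form :=
  { vp ⇒ᵢ (vq ⇒ᵢ vp),
    (vp ⇒ᵢ (vq ⇒ᵢ vr)) ⇒ᵢ ((vp ⇒ᵢ vq) ⇒ᵢ (vp ⇒ᵢ vr)),
    (vp ∧ₗ vq) ⇒ᵢ vp,
    (vp ∧ₗ vq) ⇒ᵢ vq,
    (vr ⇒ᵢ vp) ⇒ᵢ ((vr ⇒ᵢ vq) ⇒ᵢ (vr ⇒ᵢ (vp ∧ₗ vq))),
    vp ⇒ᵢ (vp ∨ₗ vq),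
    vq ⇒ᵢ (vp ∨ₗ vq),
    (vp ⇒ᵢ vr) ⇒ᵢ ((vq ⇒ᵢ vr) ⇒ᵢ ((vp ∨ₗ vq) ⇒ᵢ vr)),
    (vp ⇒ᵢ vq) ⊃ᶜ (vp ⊃ᶜ vq),
    (vp ⊃ᶜ (vq ⊃ᶜ vr)) ⇒ᵢ ((vp ⊃ᶜ vq) ⊃ᶜ (vp ⊃ᶜ vr)),
    (vp ⊃ᶜ (vq ⇒ᵢ vr)) ⇒ᵢ (vq ⇒ᵢ (vp ⊃ᶜ vr)),
    (vp ⇒ᵢ (vq ⊃ᶜ vr)) ⇒ᵢ (vq ⊃ᶜ (vp ⇒ᵢ vr)),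
    ((vp ⊃ᶜ vq) ⊃ᶜ vr) ⇒ᵢ ((vp ⊃ᶜ vr) ⇒ᵢ vr) }

/-- The system without `axM6`, in the full language with `⊥`. -/
def SbotMinus2 : HSystem where
  lang := Set.univ
  ax := insert ax0 baseAx
  figs := ∅

/-- The full system with `axM6` and with `⊥`. -/
def Sbot2 : HSystem := SbotMinus2.addAx axM6

/-- The system without `axM6` and without `⊥`, in the language `∧, ∨, →, ⊃`. -/
def SMinus2 : HSystem where
  lang := {A | A.BotFree}
  ax := baseAx
  figs := ∅

/-- The system with `axM6` in the language `∧, ∨, →, ⊃` without `⊥`. -/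
def Splain2 : HSystem := SMinus2.addAx axM6

end Systems

end MixedLogic

/-!
A formula is evaluated in a Heyting algebra `H` with `A ⊃ B` read as "the value of `B` if `A` has
value `⊤`, and `⊤` otherwise"; it is valid if its value is always `⊤`. Every Heyting algebra
validates `SbotMinus2` (`SbotMinus2_ax_valid`), but `axM6` is valid precisely when `⊤` is
join-prime, that is, when `a ⊔ b = ⊤` forces `a = ⊤` or `b = ⊤` (`axM6_valid` is one direction).
It fails in the four-element Boolean algebra `Bool × Bool`, whose top is the join of two atoms
(`not_valid_axM6`).

Adjoining a new top element to `H` makes the top join-prime, so `WithTop H` validates `Sbot2`. The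
map `liftTop : H → WithTop H` that sends `⊤` to the new top and fixes every other element preserves
`∧`, `→` and `⊃`, and also `⊥` if `H` is nontrivial, but in general not `∨`; and only `⊤` is sent
to the new top. Hence a disjunction-free theorem of `Sbot2` is valid in every nontrivial Heyting
algebra (`valid_of_Sbot2_provable`). In particular `Bool × Bool` validates `SbotMinus2` and all
disjunction-free theorems of `Sbot2`, so these cannot yield `axM6`.

For a rule that is admissible in `Sbot2`, everything derived with it remains a theorem of `Sbot2`, so
its disjunction-free conclusions are again valid in `Bool × Bool`. The other parts reduce to this:
an axiom is a rule without premises, and the `⊥`-free systems are subsystems of the full ones.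
-/

namespace MixedLogic

/-! ### Evaluation in Heyting algebras -/

open Classical in
/-- The classical implication of a Heyting algebra: its antecedent counts as true only if
it is `⊤`, and then the value is that of the consequent. -/
noncomputable def topImp {H : Type*} [HeytingAlgebra H] (a b : H) : H :=
  if a = ⊤ then b else ⊤

section Eval

variable {H : Type*} [HeytingAlgebra H]

@[simp] lemma topImp_top (b : H) : topImp ⊤ b = b := if_pos rfl

lemma topImp_of_ne {a : H} (h : a ≠ ⊤) (b : H) : topImp a b = ⊤ := if_neg h

lemma topImp_eq_top_iff {a b : H} : topImp a b = ⊤ ↔ (a = ⊤ → b = ⊤) := by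
  by_cases h : a = ⊤ <;> simp [topImp, h]

/-- The value of a formula in a Heyting algebra under an assignment to the variables. -/
noncomputable def Form.eval (v : ℕ → H) : Form → H
  | var n => v n
  | bot => ⊥
  | and A B => eval v A ⊓ eval v B
  | or A B => eval v A ⊔ eval v B
  | imp A B => eval v A ⇨ eval v B
  | cimp A B => topImp (eval v A) (eval v B)

lemma Form.eval_subst (v : ℕ → H) (p : ℕ) (B A : Form) :
    (A.subst p B).eval v = A.eval (Function.update v p (B.eval v)) := by
  induction A with
  | var n => by_cases h : n = p <;> simp [subst, eval, h]
  | bot => rfl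
  | _ => simp_all [subst, eval]

variable (H) in
/-- A formula is valid in a Heyting algebra if it has value `⊤` under every assignment. -/
def Form.Valid (A : Form) : Prop := ∀ v : ℕ → H, A.eval v = ⊤

lemma Form.Valid.mp {A B : Form} (hA : A.Valid H) (hAB : (Form.cimp A B).Valid H) :
    B.Valid H :=
  fun v => topImp_eq_top_iff.1 (hAB v) (hA v)

lemma Form.Valid.subst {A : Form} (hA : A.Valid H) (p : ℕ) (B : Form) :
    (A.subst p B).Valid H :=
  fun v => (Form.eval_subst v p B A).trans (hA _)

lemma HSystem.Provable.valid {S : HSystem} (hfigs : S.figs = ∅) (hax : ∀ A ∈ S.ax, A.Valid H)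
    {A : Form} (h : S.Provable A) : A.Valid H := by
  induction h with
  | ofAx hA => exact hax _ hA
  | mp _ _ hA hAB => exact hA.mp hAB
  | sub p B _ _ hA => exact hA.subst p B
  | fig F hF => simp [hfigs] at hF

/-! ### Soundness -/

lemma SbotMinus2_ax_valid {A : Form} (hA : A ∈ SbotMinus2.ax) : A.Valid H := by
  intro v
  simp only [SbotMinus2, baseAx, Set.mem_insert_iff, Set.mem_singleton_iff] at hA
  rcases hA with rfl | rfl | rfl | rfl | rfl | rfl | rfl | rfl | rfl | rfl | rfl | rfl | rfl | rfl
  all_goals simp only [ax0, Form.eval]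
  all_goals generalize v 0 = p
  all_goals try generalize v 1 = q
  all_goals try generalize v 2 = r
  · simp
  · simp
  · rw [himp_eq_top_iff, himp_himp, himp_himp, le_himp_iff, himp_inf_self]
    exact (inf_le_inf_left _ (le_of_eq (inf_comm q p))).trans himp_inf_le
  · simp
  · simp
  · rw [himp_inf_distrib, himp_eq_top_iff, le_himp_iff]
  · simp
  · simp
  · simp [sup_himp_distrib]
  · simp only [topImp_eq_top_iff, himp_eq_top_iff]
    rintro h rfl
    exact top_le_iff.1 h
  · by_cases hp : p = ⊤
    · subst hp; simp
    · simp [topImp_of_ne hp]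
  · by_cases hp : p = ⊤
    · subst hp; simp
    · simp [topImp_of_ne hp]
  · by_cases hq : q = ⊤
    · subst hq; simp
    · simp [topImp_of_ne hq]
  · by_cases hp : p = ⊤
    · subst hp; simp
    · simp [topImp_of_ne hp]

lemma axM6_valid (hprime : ∀ a b : H, a ⊔ b = ⊤ → a = ⊤ ∨ b = ⊤) : axM6.Valid H := by
  intro v
  simp only [axM6, Form.eval]
  generalize v 0 = p, v 1 = q, v 2 = r
  by_cases hpq : p ⊔ q = ⊤
  · rcases hprime p q hpq with rfl | rfl <;> simp
  · simp [topImp_of_ne hpq]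

lemma not_valid_axM6 : ¬ axM6.Valid (Bool × Bool) := by
  intro h
  -- `p` and `q` are the two atoms, which are complementary, and `r` is `⊥`.
  have h := h fun n => (n == 0, n == 1)
  have h₀ : ((true, false) : Bool × Bool) ≠ ⊤ := by decide
  have h₁ : ((false, true) : Bool × Bool) ≠ ⊤ := by decide
  have h₂ : ((true, false) : Bool × Bool) ⊔ (false, true) = ⊤ := by decide
  have h₃ : ((false, false) : Bool × Bool) ≠ ⊤ := by decide
  simp [axM6, Form.eval, topImp_of_ne h₀, topImp_of_ne h₁, h₂, h₃] at h

end Eval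

/-! ### Adjoining a top element -/

section AdjoinTop

variable {H : Type*} [HeytingAlgebra H]

open Classical in
/-- The Heyting algebra obtained by adding a new top element. The old top becomes the
greatest proper element. -/
noncomputable instance : HeytingAlgebra (WithTop H) where
  himp
    | _, ⊤ => ⊤
    | ⊤, (b : H) => b
    | (a : H), (b : H) => if a ≤ b then ⊤ else ((a ⇨ b : H) : WithTop H)
  le_himp_iff a b c := by
    induction c using WithTop.recTopCoe with
    | top => simp
    | coe c =>
      induction b using WithTop.recTopCoe with
      | top => simp
      | coe b =>
        by_cases h : b ≤ c
        · have : a ⊓ (b : WithTop H) ≤ (c : WithTop H) :=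
            inf_le_right.trans (WithTop.coe_le_coe.2 h)
          simp [h, this]
        · induction a using WithTop.recTopCoe with
          | top => simp [h]
          | coe a => simp [h, ← WithTop.coe_inf]
  -- The least element is the old `⊥`, so the complement is the implication above with `b = ⊥`.
  compl
    | ⊤ => ((⊥ : H) : WithTop H)
    | (a : H) => if a ≤ ⊥ then ⊤ else ((a ⇨ ⊥ : H) : WithTop H)
  himp_bot a := by
    induction a using WithTop.recTopCoe <;> rfl

lemma himp_coe_coe_of_not_le {a b : H} (h : ¬ a ≤ b) :
    (a : WithTop H) ⇨ (b : WithTop H) = ((a ⇨ b : H) : WithTop H) := if_neg h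

open Classical in
/-- The map from a Heyting algebra to the one with a new top element which moves the old top
to the new one and fixes all other elements. -/
noncomputable def liftTop (a : H) : WithTop H := if a = ⊤ then ⊤ else a

@[simp] lemma liftTop_top : liftTop (⊤ : H) = ⊤ := if_pos rfl

lemma liftTop_of_ne {a : H} (h : a ≠ ⊤) : liftTop a = a := if_neg h

lemma liftTop_eq_top_iff {a : H} : liftTop a = ⊤ ↔ a = ⊤ := by
  by_cases h : a = ⊤ <;> simp [liftTop, h]

lemma liftTop_bot [Nontrivial H] : liftTop (⊥ : H) = ⊥ := liftTop_of_ne bot_ne_top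

lemma liftTop_inf (a b : H) : liftTop (a ⊓ b) = liftTop a ⊓ liftTop b := by
  by_cases ha : a = ⊤
  · simp [ha]
  by_cases hb : b = ⊤
  · simp [hb]
  rw [liftTop_of_ne ha, liftTop_of_ne hb, liftTop_of_ne (by simp [ha]), WithTop.coe_inf]

lemma liftTop_himp (a b : H) : liftTop (a ⇨ b) = liftTop a ⇨ liftTop b := by
  by_cases ha : a = ⊤
  · simp [ha]
  by_cases hb : b = ⊤
  · simp [hb]
  rw [liftTop_of_ne ha, liftTop_of_ne hb]
  by_cases h : a ≤ b
  · rw [himp_eq_top_iff.2 h, himp_eq_top_iff.2 (WithTop.coe_le_coe.2 h), liftTop_top]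
  · rw [himp_coe_coe_of_not_le h, liftTop_of_ne (mt himp_eq_top_iff.1 h)]

lemma liftTop_topImp (a b : H) : liftTop (topImp a b) = topImp (liftTop a) (liftTop b) := by
  by_cases ha : a = ⊤
  · simp [ha]
  · rw [topImp_of_ne ha, topImp_of_ne (mt liftTop_eq_top_iff.1 ha), liftTop_top]

lemma eval_liftTop [Nontrivial H] (v : ℕ → H) {A : Form} (hA : A.DisjFree) :
    A.eval (liftTop ∘ v) = liftTop (A.eval v) := by
  induction A with
  | var n => rfl
  | bot => exact liftTop_bot.symm
  | and A B ihA ihB => simp [Form.eval, liftTop_inf, ihA hA.1, ihB hA.2]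
  | or A B => exact hA.elim
  | imp A B ihA ihB => simp [Form.eval, liftTop_himp, ihA hA.1, ihB hA.2]
  | cimp A B ihA ihB => simp [Form.eval, liftTop_topImp, ihA hA.1, ihB hA.2]

lemma Sbot2_valid_withTop {A : Form} (h : Sbot2.Provable A) : A.Valid (WithTop H) := by
  refine h.valid rfl ?_
  rintro B (rfl | hB)
  · refine axM6_valid fun a b hab => ?_
    induction a using WithTop.recTopCoe with
    | top => exact .inl rfl
    | coe a =>
      induction b using WithTop.recTopCoe with
      | top => exact .inr rfl
      | coe b => exact absurd hab (WithTop.coe_ne_top (a := a ⊔ b))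
  · exact SbotMinus2_ax_valid hB

/-- Disjunction-free theorems of the full system hold in every nontrivial Heyting algebra,
even where `axM6` fails. -/
lemma valid_of_Sbot2_provable [Nontrivial H] {A : Form} (hA : A.DisjFree)
    (h : Sbot2.Provable A) : A.Valid H := fun v =>
  liftTop_eq_top_iff.1 ((eval_liftTop v hA).symm.trans (Sbot2_valid_withTop h _))

end AdjoinTop

/-! ### Comparison of systems -/

lemma HSystem.Provable.mono {S T : HSystem} (hlang : S.lang ⊆ T.lang) (hax : S.ax ⊆ T.ax)
    (hfigs : S.figs ⊆ T.figs) {A : Form} (h : S.Provable A) : T.Provable A := by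
  induction h with
  | ofAx hA => exact .ofAx (hax hA)
  | mp _ _ hA hAB => exact .mp hA hAB
  | sub p B hB _ hA => exact .sub p B (hlang hB) hA
  | fig F hF _ ih => exact .fig F (hfigs hF) ih

lemma Form.Implicational.disjFree {A : Form} (hA : A.Implicational) : A.DisjFree := by
  induction A with
  | var | bot => trivial
  | and | or => exact hA.elim
  | imp A B ihA ihB | cimp A B ihA ihB => exact ⟨ihA hA.1, ihB hA.2⟩

/-- Provability in `Sbot2` is carried along in the induction: it makes admissibility applicable to
the premises of a figure. -/
lemma SbotMinus2_addRule_sound {R : Set Figure} (hR : ∀ F ∈ R, F.concl.DisjFree)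
    (hadm : Sbot2.Admissible R) {H : Type*} [HeytingAlgebra H] [Nontrivial H] {A : Form}
    (h : (SbotMinus2.addRule R).Provable A) : Sbot2.Provable A ∧ A.Valid H := by
  induction h with
  | ofAx hA => exact ⟨.ofAx (Set.mem_insert_of_mem _ hA), SbotMinus2_ax_valid hA⟩
  | mp _ _ hA hAB => exact ⟨.mp hA.1 hAB.1, hA.2.mp hAB.2⟩
  | sub p B hB _ hA => exact ⟨.sub p B hB hA.1, hA.2.subst p B⟩
  | fig F hF _ ih =>
    have hFR : F ∈ R := hF.resolve_left (Set.notMem_empty F)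
    have hp := hadm F hFR fun A hA => (ih A hA).1
    exact ⟨hp, valid_of_Sbot2_provable (hR F hFR) hp⟩

lemma not_addRule_provable_axM6 {R : Set Figure} (hR : ∀ F ∈ R, F.concl.DisjFree)
    (hadm : Sbot2.Admissible R) : ¬ (SbotMinus2.addRule R).Provable axM6 := fun h =>
  not_valid_axM6 (SbotMinus2_addRule_sound hR hadm h).2

lemma HSystem.Provable.addRule_of_addAx {S : HSystem} {A B : Form}
    (h : (S.addAx A).Provable B) : (S.addRule {⟨[], A⟩}).Provable B := by
  induction h with
  | ofAx hB =>
    rcases hB with rfl | hB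
    · exact .fig ⟨[], _⟩ (.inr rfl) (by simp)
    · exact .ofAx hB
  | mp _ _ hA hAB => exact .mp hA hAB
  | sub p B hB _ hA => exact .sub p B hB hA
  | fig F hF _ ih => exact .fig F (.inl hF) ih

lemma not_addAx_provable_axM6 {A : Form} (hA : A.DisjFree) (h : Sbot2.Provable A) :
    ¬ (SbotMinus2.addAx A).Provable axM6 := by
  refine fun hM => not_addRule_provable_axM6 ?_ ?_ hM.addRule_of_addAx
  · rintro F rfl
    exact hA
  · rintro F rfl _
    exact h

end MixedLogic

theorem mainTheorem3 :
    -- no provable disjunction-free formula yields `axM6`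
    (¬ ∃ A : MixedLogic.Form, A.DisjFree ∧ MixedLogic.Sbot2.Provable A ∧
        (MixedLogic.SbotMinus2.addAx A).Provable MixedLogic.axM6) ∧
    -- no admissible rule with disjunction-free conclusions yields `axM6`
    (¬ ∃ R : Set MixedLogic.Figure, (∀ F ∈ R, F.concl.DisjFree) ∧
        MixedLogic.Sbot2.Admissible R ∧
        (MixedLogic.SbotMinus2.addRule R).Provable MixedLogic.axM6) ∧
    -- `axM6` cannot be replaced by an implicational axiom
    (¬ ∃ A : MixedLogic.Form, A.Implicational ∧
        ∀ B : MixedLogic.Form,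
          (MixedLogic.SbotMinus2.addAx A).Provable B ↔ MixedLogic.Sbot2.Provable B) ∧
    -- nor by a disjunction-free axiom when `⊥` is absent from the language
    (¬ ∃ A : MixedLogic.Form, A.DisjFree ∧ A.BotFree ∧ MixedLogic.Splain2.Provable A ∧
        (MixedLogic.SMinus2.addAx A).Provable MixedLogic.axM6) := by
  open MixedLogic in
  refine ⟨?_, ?_, ?_, ?_⟩
  · rintro ⟨A, hA, hp, hM⟩
    exact not_addAx_provable_axM6 hA hp hM
  · rintro ⟨R, hR, hadm, hM⟩
    exact not_addRule_provable_axM6 hR hadm hM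
  · rintro ⟨A, hA, hiff⟩
    exact not_addAx_provable_axM6 hA.disjFree ((hiff A).1 (.ofAx (Set.mem_insert _ _)))
      ((hiff axM6).2 (.ofAx (Set.mem_insert _ _)))
  · rintro ⟨A, hA, -, hp, hM⟩
    have hax : SMinus2.ax ⊆ SbotMinus2.ax := Set.subset_insert _ _
    have hp' : Sbot2.Provable A :=
      HSystem.Provable.mono (S := Splain2) (T := Sbot2) (Set.subset_univ _) (Set.insert_subset_insert hax)
        subset_rfl hp
    have hM' : (SbotMinus2.addAx A).Provable axM6 :=
      HSystem.Provable.mono (S := SMinus2.addAx A) (T := SbotMinus2.addAx A)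
        (Set.subset_univ _) (Set.insert_subset_insert hax) subset_rfl hM
    exact not_addAx_provable_axM6 hA hp' hM'
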